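/- Let $n\ge 0$ and $d\ge 2$ be integers and let $f,g:\{0,1\}^n\to\mathbb{R}$ be arbitrary functions. Let $\mathbb{E}$ denote expectation with respect to the uniform distribution on $\{0,1\}^n$, let $\|h\|_p=(\mathbb{E}|h|^p)^{1/p}$, and for $S\subseteq[n]$ let $\hat f(S)=\mathbb{E}[f\chi_S]$, where $\chi_S(x)=(-1)^{\sum_{i\in S}x_i}$. For $i\in[n]$ let $\partial_i f(x)=f(x^{(i\to 1)})-f(x^{(i\to 0)})$, where $x^{(i\to b)}$ is $x$ with its $i$-th coordinate replaced by $b$, and for $T=\{i_1,\dots,i_d\}\subseteq[n]$ with $|T|=d$ let $\partial_T f=\partial_{i_1}\circ\cdots\circ\partial_{i_d}(f)$ (the order is immaterial). Then $$\Bigl|\sum_{|S|\ge d}\hat f(S)\hat g(S)\Bigr|\le C_d\sum_{T\subseteq[n],\,|T|=d}\frac{\|\partial_T f\|_2\,\|\partial_T g\|_2}{1+\log\left(\dfrac{\|\partial_T f\|_2\,\|\partial_T g\|_2}{\|\partial_T f\|_1\,\|\partial_T g\|_1}\right)},\qquad C_d=\frac{1+(2^d\,d!)^{1/d}}{4^d},$$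 where $\log$ is the natural logarithm and a summand with $\partial_T f=0$ or $\partial_T g=0$ is understood to be $0$. -/

import Mathlib

noncomputable section

namespace BoolCube

/-- The expectation of `f` under the uniform probability measure on `{0,1}^n`. -/
def expect {n : ℕ} (f : (Fin n → Bool) → ℝ) : ℝ :=
  (∑ x, f x) / 2 ^ n

/-- The Walsh character `χ_S(x) = (-1)^{∑_{i ∈ S} x_i}`. -/
def walsh {n : ℕ} (S : Finset (Fin n)) (x : Fin n → Bool) : ℝ :=
  (-1) ^ (∑ i ∈ S, (x i).toNat)

/-- The Fourier-Walsh coefficient `f̂(S) = E[f χ_S]`. -/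
def fourier {n : ℕ} (f : (Fin n → Bool) → ℝ) (S : Finset (Fin n)) : ℝ :=
  expect fun x => f x * walsh S x

/-- The normalized norm `‖f‖_p = (E |f|^p)^{1/p}`. -/
def lpNorm {n : ℕ} (p : ℝ) (f : (Fin n → Bool) → ℝ) : ℝ :=
  (expect fun x => |f x| ^ p) ^ (1 / p)

/-- The discrete derivative `∂_i f(x) = f(x^{(i→1)}) - f(x^{(i→0)})`. It does not depend on the
coordinate `x_i`; we keep it as a function on the whole cube, which changes no expectation. -/
def partialDeriv {n : ℕ} (i : Fin n) (f : (Fin n → Bool) → ℝ) : (Fin n → Bool) → ℝ :=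
  fun x => f (Function.update x i true) - f (Function.update x i false)

/-- Discrete derivatives along different coordinates commute. -/
theorem partialDeriv_comm {n : ℕ} (i j : Fin n) (f : (Fin n → Bool) → ℝ) :
    partialDeriv i (partialDeriv j f) = partialDeriv j (partialDeriv i f) := by
  rcases eq_or_ne i j with rfl | h
  · rfl
  · funext x
    simp only [partialDeriv, Function.update_comm h]
    ring

instance instLeftCommutativePartialDeriv {n : ℕ} :
    LeftCommutative (partialDeriv : Fin n → ((Fin n → Bool) → ℝ) → (Fin n → Bool) → ℝ) :=
  ⟨partialDeriv_comm⟩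

/-- The iterated derivative `∂_T f = ∂_{i_1} ∘ ⋯ ∘ ∂_{i_d} (f)` for `T = {i_1, …, i_d}`; the order
of composition is immaterial. -/
def iterDeriv {n : ℕ} (T : Finset (Fin n)) (f : (Fin n → Bool) → ℝ) : (Fin n → Bool) → ℝ :=
  T.val.foldr partialDeriv f

/-- The constant `C_d = (1 + (2^d d!)^{1/d}) / 4^d`. -/
def levelConst (d : ℕ) : ℝ :=
  (1 + ((2 : ℝ) ^ d * (d.factorial : ℝ)) ^ (1 / (d : ℝ))) / 4 ^ d

end BoolCube

end

/-! Write `noiseForm ρ F G` for `⟨F, T_ρ G⟩`. Since `∂_T` multiplies the coefficient at `S ⊇ T` by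
`(-2)^d` and moves it to `S \ T`, the form at `∂_T f`, `∂_T g` weights `f̂(S)ĝ(S)` by `4^d
ρ^(|S|-d)`. Integrating against `d(1-ρ)^(d-1)` and summing over `T` gives every `S` with `|S| ≥ d`
total weight `4^d`, because a Beta integral cancels `|S| choose d` (`level_sum_eq`).

It remains to bound each `T`. Cauchy–Schwarz, hypercontractivity (`noiseForm_hypercontractive`) and
interpolation between `L¹` and `L²` give `|⟨F, T_ρ G⟩| ≤ N exp(-L(1-ρ)/2)`, where `N` is the product
of the 2-norms and `L` the logarithm in the theorem (`abs_noiseForm_le_exp`). Integrating in `ρ`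
yields the factor `1/(1+L)` (`integral_kernel_mul_exp_le`). -/

open MeasureTheory

namespace BoolCube

/-! ### Two-point inequality -/

/-- The scalar inequality behind the two-point hypercontractive estimate. -/
theorem two_point_rpow_lower {ρ t : ℝ} (hρ : 0 ≤ ρ) (hρ' : ρ ≤ 1) (ht : 0 ≤ t) (ht' : t ≤ 1) :
    2 + (1 + ρ) * ρ * t ^ 2 ≤ (1 + t) ^ (1 + ρ) + (1 - t) ^ (1 + ρ) := by
  -- Up to the factor `1 + ρ`, this function is the derivative of the one in `key2`: the inequality
  -- is integrated twice from `t = 0`.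
  have key1 : MonotoneOn (fun t : ℝ => (1 + t) ^ ρ - (1 - t) ^ ρ - 2 * ρ * t) (Set.Icc 0 1) := by
    apply monotoneOn_of_deriv_nonneg (convex_Icc 0 1)
    · apply ContinuousOn.sub
      · apply ContinuousOn.sub
        · exact ContinuousOn.rpow_const (by fun_prop) fun x hx => Or.inr hρ
        · exact ContinuousOn.rpow_const (by fun_prop) fun x hx => Or.inr hρ
      · fun_prop
    · intro x hx
      rw [interior_Icc] at hx
      have h1 : (1 + x) ≠ 0 := by linarith [hx.1]
      have h2 : (1 - x) ≠ 0 := by linarith [hx.2]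
      apply DifferentiableAt.differentiableWithinAt
      fun_prop (disch := simp [h1, h2])
    · intro x hx
      rw [interior_Icc] at hx
      have h1 : 0 < (1 + x) := by linarith [hx.1]
      have h2 : 0 < (1 - x) := by linarith [hx.2]
      have d1 : HasDerivAt (fun t : ℝ => (1 + t) ^ ρ) (1 * ρ * (1 + x) ^ (ρ - 1)) x :=
        ((hasDerivAt_id x).const_add 1).rpow_const (Or.inl h1.ne')
      have d2 : HasDerivAt (fun t : ℝ => (1 - t) ^ ρ) (-1 * ρ * (1 - x) ^ (ρ - 1)) x :=
        ((hasDerivAt_id x).const_sub 1).rpow_const (Or.inl h2.ne')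
      have d3 : HasDerivAt (fun t : ℝ => 2 * ρ * t) (2 * ρ * 1) x :=
        (hasDerivAt_id x).const_mul (2 * ρ)
      rw [((d1.fun_sub d2).fun_sub d3).deriv]
      -- The product is `(1 - x²)^((ρ-1)/2)`, a nonpositive power of a number in `(0, 1]`; AM–GM
      -- then gives `e3`.
      have e1 : 1 ≤ (1 + x) ^ ((ρ - 1) / 2) * (1 - x) ^ ((ρ - 1) / 2) := by
        rw [← Real.mul_rpow h1.le h2.le]
        exact Real.one_le_rpow_of_pos_of_le_one_of_nonpos (mul_pos h1 h2)
          (by nlinarith [sq_nonneg x]) (by linarith)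
      have e2 : ∀ u : ℝ, 0 < u → u ^ (ρ - 1) = (u ^ ((ρ - 1) / 2)) ^ 2 := fun u hu => by
        rw [← Real.rpow_natCast, ← Real.rpow_mul hu.le]; congr 1; push_cast; ring
      have e3 : 2 ≤ (1 + x) ^ (ρ - 1) + (1 - x) ^ (ρ - 1) := by
        rw [e2 _ h1, e2 _ h2]
        nlinarith [sq_nonneg ((1 + x) ^ ((ρ - 1) / 2) - (1 - x) ^ ((ρ - 1) / 2))]
      have := mul_nonneg hρ (show 0 ≤ (1 + x) ^ (ρ - 1) + (1 - x) ^ (ρ - 1) - 2 by linarith)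
      linarith
  have key2 : MonotoneOn (fun t : ℝ => (1 + t) ^ (1 + ρ) + (1 - t) ^ (1 + ρ)
      - (1 + ρ) * ρ * t ^ 2) (Set.Icc 0 1) := by
    apply monotoneOn_of_deriv_nonneg (convex_Icc 0 1)
    · apply ContinuousOn.sub
      · apply ContinuousOn.add
        · exact ContinuousOn.rpow_const (by fun_prop) fun x hx => Or.inr (by linarith)
        · exact ContinuousOn.rpow_const (by fun_prop) fun x hx => Or.inr (by linarith)
      · fun_prop
    · intro x hx
      rw [interior_Icc] at hx
      have h1 : (1 + x) ≠ 0 := by linarith [hx.1]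
      have h2 : (1 - x) ≠ 0 := by linarith [hx.2]
      apply DifferentiableAt.differentiableWithinAt
      fun_prop (disch := simp [h1, h2])
    · intro x hx
      rw [interior_Icc] at hx
      have h1 : 0 < (1 + x) := by linarith [hx.1]
      have h2 : 0 < (1 - x) := by linarith [hx.2]
      have d1 : HasDerivAt (fun t : ℝ => (1 + t) ^ (1 + ρ)) (1 * (1 + ρ) * (1 + x) ^ (1 + ρ - 1)) x :=
        ((hasDerivAt_id x).const_add 1).rpow_const (Or.inl h1.ne')
      have d2 : HasDerivAt (fun t : ℝ => (1 - t) ^ (1 + ρ)) (-1 * (1 + ρ) * (1 - x) ^ (1 + ρ - 1)) x :=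
        ((hasDerivAt_id x).const_sub 1).rpow_const (Or.inl h2.ne')
      have d3 : HasDerivAt (fun t : ℝ => (1 + ρ) * ρ * t ^ 2) ((1 + ρ) * ρ * (2 * x)) x := by
        simpa using (hasDerivAt_pow 2 x).const_mul ((1 + ρ) * ρ)
      rw [((d1.fun_add d2).fun_sub d3).deriv, add_sub_cancel_left]
      have := key1 (Set.left_mem_Icc.2 zero_le_one) ⟨hx.1.le, hx.2.le⟩ hx.1.le
      simp only [add_zero, sub_zero, mul_zero, sub_self, Real.one_rpow] at this
      have := mul_nonneg (show 0 ≤ 1 + ρ by linarith) this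
      linarith
  have := key2 (Set.left_mem_Icc.2 zero_le_one) ⟨ht, ht'⟩ ht
  norm_num at this
  linarith

/-- The two-point hypercontractive inequality for nonnegative values. -/
theorem two_point_hypercontractive {ρ A B : ℝ} (hρ : 0 ≤ ρ) (hρ' : ρ ≤ 1)
    (hA : 0 ≤ A) (hB : 0 ≤ B) :
    (((A + B) / 2) ^ 2 + ρ * ((A - B) / 2) ^ 2) ^ ((1 + ρ) / 2) ≤
      (A ^ (1 + ρ) + B ^ (1 + ρ)) / 2 := by
  wlog hAB : B ≤ A generalizing A B
  · have := this hB hA (le_of_not_ge hAB)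
    rwa [add_comm B A, ← neg_sub A B, neg_div, neg_sq, add_comm (B ^ (1 + ρ))] at this
  rcases (add_nonneg hA hB).eq_or_lt with h | h
  · have hA0 : A = 0 := by linarith
    have hB0 : B = 0 := by linarith
    subst hA0 hB0
    have h1 : (1 + ρ) / 2 ≠ 0 := by positivity
    have h2 : (1 + ρ) ≠ 0 := by positivity
    simp [Real.zero_rpow h1, Real.zero_rpow h2]
  set m := (A + B) / 2 with hm
  have hm0 : 0 < m := by positivity
  set t := (A - B) / (A + B) with ht
  have ht0 : 0 ≤ t := div_nonneg (by linarith) h.le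
  have ht1 : t ≤ 1 := (div_le_one h).2 (by linarith)
  have eA : A = m * (1 + t) := by rw [hm, ht]; field_simp; ring
  have eB : B = m * (1 - t) := by rw [hm, ht]; field_simp; ring
  have e : m ^ 2 + ρ * ((A - B) / 2) ^ 2 = m ^ 2 * (1 + ρ * t ^ 2) := by
    rw [hm, ht]; field_simp
  have hs : 0 ≤ ρ * t ^ 2 := by positivity
  have hmp : (m ^ 2) ^ ((1 + ρ) / 2) = m ^ (1 + ρ) := by
    rw [← Real.rpow_natCast, ← Real.rpow_mul hm0.le]; congr 1; push_cast; ring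
  rw [e, Real.mul_rpow (by positivity) (by positivity), hmp]
  have eA' : A ^ (1 + ρ) = m ^ (1 + ρ) * (1 + t) ^ (1 + ρ) := by
    rw [← Real.mul_rpow hm0.le (by linarith), ← eA]
  have eB' : B ^ (1 + ρ) = m ^ (1 + ρ) * (1 - t) ^ (1 + ρ) := by
    rw [← Real.mul_rpow hm0.le (by linarith), ← eB]
  rw [eA', eB', ← mul_add, mul_div_assoc]
  apply mul_le_mul_of_nonneg_left _ (by positivity)
  -- Bernoulli for an exponent at most 1 linearises the left side and leaves the scalar inequality.
  have b := rpow_one_add_le_one_add_mul_self (s := ρ * t ^ 2) (by linarith)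
    (show 0 ≤ (1 + ρ) / 2 by linarith) (by linarith)
  have := two_point_rpow_lower hρ hρ' ht0 ht1
  linarith

/-! ### Noise form and hypercontractivity -/

/-- The bilinear form `⟨f, T_ρ g⟩` of the noise operator, on the Fourier side. -/
noncomputable def noiseForm {n : ℕ} (ρ : ℝ) (f g : (Fin n → Bool) → ℝ) : ℝ :=
  ∑ S : Finset (Fin n), ρ ^ S.card * (fourier f S * fourier g S)

theorem walsh_eq_prod {n : ℕ} (S : Finset (Fin n)) (x : Fin n → Bool) :
    walsh S x = ∏ i ∈ S, (-1 : ℝ) ^ (x i).toNat := by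
  rw [walsh, Finset.prod_pow_eq_pow_sum]

/-- Expanding the product over subsets recovers the Fourier side. The kernel factors over
coordinates, which permits induction on `n`. -/
theorem noiseForm_eq_kernel {n : ℕ} (ρ : ℝ) (f g : (Fin n → Bool) → ℝ) :
    noiseForm ρ f g = (∑ x, ∑ y, f x * g y *
      ∏ i, (1 + ρ * ((-1) ^ (x i).toNat * (-1) ^ (y i).toNat))) / 4 ^ n := by
  have h4 : (4 : ℝ) ^ n = 2 ^ n * 2 ^ n := by rw [← mul_pow]; norm_num
  have e : ∀ S : Finset (Fin n), fourier f S * fourier g S =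
      (∑ x, ∑ y, f x * walsh S x * (g y * walsh S y)) / 4 ^ n := fun S => by
    rw [fourier, fourier, expect, expect, div_mul_div_comm, ← h4, Finset.sum_mul_sum]
  simp only [noiseForm, e, Finset.prod_one_add, Finset.powerset_univ,
    Finset.prod_mul_distrib, Finset.prod_const, ← walsh_eq_prod, ← mul_div_assoc,
    ← Finset.sum_div, Finset.mul_sum]
  congr 1
  rw [Finset.sum_comm]
  refine Finset.sum_congr rfl fun x _ => ?_
  rw [Finset.sum_comm]
  refine Finset.sum_congr rfl fun y _ => Finset.sum_congr rfl fun S _ => ?_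
  ring

theorem sum_cube_succ {n : ℕ} (F : (Fin (n + 1) → Bool) → ℝ) :
    ∑ x, F x = ∑ x, F (Fin.cons true x) + ∑ x, F (Fin.cons false x) := by
  rw [← (Fin.consEquiv fun _ : Fin (n + 1) => Bool).sum_comp, Fintype.sum_prod_type,
    Fintype.sum_bool]
  rfl

theorem expect_succ {n : ℕ} (F : (Fin (n + 1) → Bool) → ℝ) :
    expect F = (expect (fun x => F (Fin.cons true x)) + expect fun x => F (Fin.cons false x)) / 2 := by
  rw [expect, sum_cube_succ, expect, expect, pow_succ]
  field_simp

/-- The kernel factor of the first coordinate is `1 + ρ` if the two bits agree and `1 - ρ`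
otherwise. -/
theorem noiseForm_succ {n : ℕ} (ρ : ℝ) (f : (Fin (n + 1) → Bool) → ℝ) :
    noiseForm ρ f f =
      ((1 + ρ) * (noiseForm ρ (fun x => f (Fin.cons true x)) (fun x => f (Fin.cons true x)) +
        noiseForm ρ (fun x => f (Fin.cons false x)) (fun x => f (Fin.cons false x))) +
      (1 - ρ) * (noiseForm ρ (fun x => f (Fin.cons true x)) (fun x => f (Fin.cons false x)) +
        noiseForm ρ (fun x => f (Fin.cons false x)) (fun x => f (Fin.cons true x)))) / 4 := by
  have key : ∀ (s : ℝ) (b c : Bool),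
      ∑ x : Fin n → Bool, ∑ y : Fin n → Bool, f (Fin.cons b x) * f (Fin.cons c y) *
        (s * ∏ i, (1 + ρ * ((-1) ^ (x i).toNat * (-1) ^ (y i).toNat))) =
      s * (4 ^ n * noiseForm ρ (fun x => f (Fin.cons b x)) (fun x => f (Fin.cons c x))) := by
    intro s b c
    rw [noiseForm_eq_kernel, mul_div_cancel₀ _ (by positivity), Finset.mul_sum]
    refine Finset.sum_congr rfl fun x _ => ?_
    rw [Finset.mul_sum]
    refine Finset.sum_congr rfl fun y _ => ?_
    ring
  rw [noiseForm_eq_kernel]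
  simp only [sum_cube_succ, Fin.prod_univ_succ, Fin.cons_zero, Fin.cons_succ,
    Finset.sum_add_distrib, key]
  rw [pow_succ]
  field_simp
  simp
  ring

theorem noiseForm_self_nonneg {n : ℕ} {ρ : ℝ} (hρ : 0 ≤ ρ) (f : (Fin n → Bool) → ℝ) :
    0 ≤ noiseForm ρ f f :=
  Finset.sum_nonneg fun _ _ => mul_nonneg (pow_nonneg hρ _) (mul_self_nonneg _)

theorem abs_noiseForm_le {n : ℕ} {ρ : ℝ} (hρ : 0 ≤ ρ) (f g : (Fin n → Bool) → ℝ) :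
    |noiseForm ρ f g| ≤ √(noiseForm ρ f f) * √(noiseForm ρ g g) := by
  rw [← Real.sqrt_mul (noiseForm_self_nonneg hρ f)]
  apply Real.abs_le_sqrt
  have h := Finset.sum_mul_sq_le_sq_mul_sq Finset.univ
    (fun S : Finset (Fin n) => √(ρ ^ S.card) * fourier f S)
    (fun S : Finset (Fin n) => √(ρ ^ S.card) * fourier g S)
  have e : ∀ f g : (Fin n → Bool) → ℝ, ∑ S : Finset (Fin n), (√(ρ ^ S.card) * fourier f S) *
      (√(ρ ^ S.card) * fourier g S) = noiseForm ρ f g := fun f g =>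
    Finset.sum_congr rfl fun _ _ => by
      rw [mul_mul_mul_comm, Real.mul_self_sqrt (pow_nonneg hρ _)]
  simp only [sq, e] at h ⊢
  exact h

/-- The Bonami–Beckner inequality `‖T_{√ρ} f‖₂ ≤ ‖f‖_{1+ρ}`. -/
theorem noiseForm_hypercontractive {ρ : ℝ} (hρ : 0 ≤ ρ) (hρ' : ρ ≤ 1) :
    ∀ {n : ℕ} (f : (Fin n → Bool) → ℝ),
      noiseForm ρ f f ^ ((1 + ρ) / 2) ≤ expect fun x => |f x| ^ (1 + ρ) := by
  intro n
  induction n with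
  | zero =>
    intro f
    have e : ∀ c : ℝ, (c * c) ^ ((1 + ρ) / 2) = |c| ^ (1 + ρ) := fun c => by
      rw [← abs_mul_abs_self, ← sq, ← Real.rpow_natCast, ← Real.rpow_mul (abs_nonneg c)]
      congr 1; push_cast; ring
    rw [noiseForm_eq_kernel]
    simp [expect, e]
  | succ n ih =>
    intro f
    set f1 : (Fin n → Bool) → ℝ := fun x => f (Fin.cons true x)
    set f0 : (Fin n → Bool) → ℝ := fun x => f (Fin.cons false x)
    have hsq : ∀ h : (Fin n → Bool) → ℝ,
        √(noiseForm ρ h h) ^ (1 + ρ) ≤ expect fun x => |h x| ^ (1 + ρ) := fun h => by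
      refine le_trans (le_of_eq ?_) (ih h)
      rw [Real.sqrt_eq_rpow, ← Real.rpow_mul (noiseForm_self_nonneg hρ h)]
      congr 1; ring
    have q1 := Real.sq_sqrt (noiseForm_self_nonneg hρ f1)
    have q0 := Real.sq_sqrt (noiseForm_self_nonneg hρ f0)
    have c1 := (le_abs_self _).trans (abs_noiseForm_le hρ f1 f0)
    have c0 := (le_abs_self _).trans (abs_noiseForm_le hρ f0 f1)
    -- Bounding the cross terms by Cauchy–Schwarz, as `1 - ρ ≥ 0` allows, leaves exactly the
    -- two-point expression in the two square roots.
    have hle : noiseForm ρ f f ≤ ((√(noiseForm ρ f1 f1) + √(noiseForm ρ f0 f0)) / 2) ^ 2 +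
        ρ * ((√(noiseForm ρ f1 f1) - √(noiseForm ρ f0 f0)) / 2) ^ 2 := by
      have hs := mul_le_mul_of_nonneg_left (add_le_add c1 c0) (sub_nonneg.2 hρ')
      have hf : noiseForm ρ f f = ((1 + ρ) * (noiseForm ρ f1 f1 + noiseForm ρ f0 f0) +
          (1 - ρ) * (noiseForm ρ f1 f0 + noiseForm ρ f0 f1)) / 4 := noiseForm_succ ρ f
      linear_combination hf + hs / 4 - (1 + ρ) / 4 * (q1 + q0)
    calc noiseForm ρ f f ^ ((1 + ρ) / 2)
        ≤ _ := Real.rpow_le_rpow (noiseForm_self_nonneg hρ f) hle (by linarith)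
      _ ≤ _ := two_point_hypercontractive hρ hρ' (Real.sqrt_nonneg _) (Real.sqrt_nonneg _)
      _ ≤ _ := by
        rw [expect_succ]
        linarith [hsq f1, hsq f0]

/-! ### Norms, interpolation and decay of the noise form -/

theorem lpNorm_one {n : ℕ} (F : (Fin n → Bool) → ℝ) : lpNorm 1 F = expect fun x => |F x| := by
  simp [lpNorm]

theorem lpNorm_two {n : ℕ} (F : (Fin n → Bool) → ℝ) :
    lpNorm 2 F = √(expect fun x => F x ^ 2) := by
  simp [lpNorm, Real.sqrt_eq_rpow]

theorem expect_nonneg {n : ℕ} {F : (Fin n → Bool) → ℝ} (h : ∀ x, 0 ≤ F x) : 0 ≤ expect F :=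
  div_nonneg (Finset.sum_nonneg fun x _ => h x) (by positivity)

theorem lpNorm_two_sq {n : ℕ} (F : (Fin n → Bool) → ℝ) :
    lpNorm 2 F ^ 2 = expect fun x => F x ^ 2 := by
  rw [lpNorm_two, Real.sq_sqrt (expect_nonneg fun x => sq_nonneg _)]

theorem lpNorm_one_le_lpNorm_two {n : ℕ} (F : (Fin n → Bool) → ℝ) : lpNorm 1 F ≤ lpNorm 2 F := by
  rw [lpNorm_one, lpNorm_two]
  apply Real.le_sqrt_of_sq_le
  have h := sq_sum_le_card_mul_sum_sq (s := Finset.univ) (f := fun x : Fin n → Bool => |F x|)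
  simp only [sq_abs, Finset.card_univ, Fintype.card_pi, Fintype.card_bool, Finset.prod_const,
    Fintype.card_fin, Nat.cast_pow, Nat.cast_ofNat] at h
  rw [expect, expect, div_pow, div_le_div_iff₀ (by positivity) (by positivity)]
  calc _ ≤ (2 ^ n * ∑ x, F x ^ 2) * 2 ^ n := mul_le_mul_of_nonneg_right h (by positivity)
    _ = _ := by ring

theorem lpNorm_one_pos {n : ℕ} {F : (Fin n → Bool) → ℝ} (hF : F ≠ 0) : 0 < lpNorm 1 F := by
  obtain ⟨x, hx⟩ := Function.ne_iff.1 hF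
  rw [lpNorm_one]
  exact div_pos (Finset.sum_pos' (fun y _ => abs_nonneg _) ⟨x, Finset.mem_univ x, abs_pos.2 hx⟩)
    (by positivity)

/-- Log-convexity of the moments between the exponents `1` and `2`. -/
theorem expect_abs_rpow_le {n : ℕ} {ρ : ℝ} (hρ : 0 ≤ ρ) (hρ' : ρ ≤ 1) {F : (Fin n → Bool) → ℝ}
    (hF : F ≠ 0) :
    (expect fun x => |F x| ^ (1 + ρ)) ≤ lpNorm 1 F ^ (1 - ρ) * (lpNorm 2 F ^ 2) ^ ρ := by
  have hu := lpNorm_one_pos hF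
  have hv : 0 < lpNorm 2 F ^ 2 := pow_pos (hu.trans_le (lpNorm_one_le_lpNorm_two F)) 2
  set u := lpNorm 1 F with hu'
  set v := lpNorm 2 F ^ 2 with hv'
  have hc : 0 < u ^ (1 - ρ) * v ^ ρ := by positivity
  -- Weighted AM–GM for `|F|/u` and `F²/v`, each of mean 1, so the bracket averages to `(1 - ρ) + ρ
  -- = 1`.
  have pt : ∀ x, |F x| ^ (1 + ρ) ≤
      u ^ (1 - ρ) * v ^ ρ * ((1 - ρ) / u * |F x| + ρ / v * F x ^ 2) := fun x => by
    have h := Real.geom_mean_le_arith_mean2_weighted (sub_nonneg.2 hρ') hρ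
      (div_nonneg (abs_nonneg (F x)) hu.le) (div_nonneg (sq_nonneg (F x)) hv.le)
      (sub_add_cancel 1 ρ)
    rw [Real.div_rpow (abs_nonneg _) hu.le, Real.div_rpow (sq_nonneg _) hv.le, div_mul_div_comm,
      div_le_iff₀ hc] at h
    have e : |F x| ^ (1 + ρ) = |F x| ^ (1 - ρ) * (F x ^ 2) ^ ρ := by
      rw [← sq_abs, ← Real.rpow_natCast, ← Real.rpow_mul (abs_nonneg _),
        ← Real.rpow_add_of_nonneg (abs_nonneg _) (by linarith) (by positivity)]
      congr 1; push_cast; ring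
    rw [e]
    refine h.trans (le_of_eq ?_)
    ring
  have e1 : expect (fun x => |F x|) = u := (lpNorm_one F).symm
  have e2 : expect (fun x => F x ^ 2) = v := (lpNorm_two_sq F).symm
  calc (expect fun x => |F x| ^ (1 + ρ))
      ≤ expect fun x => u ^ (1 - ρ) * v ^ ρ * ((1 - ρ) / u * |F x| + ρ / v * F x ^ 2) :=
        div_le_div_of_nonneg_right (Finset.sum_le_sum fun x _ => pt x) (by positivity)
    _ = u ^ (1 - ρ) * v ^ ρ * ((1 - ρ) / u * expect (fun x => |F x|)
          + ρ / v * expect (fun x => F x ^ 2)) := by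
        simp only [expect, ← Finset.mul_sum, Finset.sum_add_distrib]; ring
    _ = _ := by
        rw [e1, e2, div_mul_cancel₀ _ hu.ne', div_mul_cancel₀ _ hv.ne', sub_add_cancel, mul_one]

/-- The natural exponent is `(1-ρ)/(1+ρ)`. Weakening it to `(1-ρ)/2`, as the base is at most 1,
makes the decay exponential in `1 - ρ`; this halving is the source of `2^d` in the constant. -/
theorem sqrt_noiseForm_self_le {n : ℕ} {ρ : ℝ} (hρ : 0 ≤ ρ) (hρ' : ρ ≤ 1)
    {F : (Fin n → Bool) → ℝ} (hF : F ≠ 0) :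
    √(noiseForm ρ F F) ≤ lpNorm 2 F * (lpNorm 1 F / lpNorm 2 F) ^ ((1 - ρ) / 2) := by
  have hu := lpNorm_one_pos hF
  have huv := lpNorm_one_le_lpNorm_two F
  have hv := hu.trans_le huv
  have h := (noiseForm_hypercontractive hρ hρ' F).trans (expect_abs_rpow_le hρ hρ' hF)
  set u := lpNorm 1 F
  set v := lpNorm 2 F
  have hr : 0 < u / v := div_pos hu hv
  have hr1 : u / v ≤ 1 := (div_le_one hv).2 huv
  rw [← Real.rpow_le_rpow_iff (Real.sqrt_nonneg _) (by positivity) (show 0 < 1 + ρ by linarith)]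
  calc √(noiseForm ρ F F) ^ (1 + ρ) = noiseForm ρ F F ^ ((1 + ρ) / 2) := by
        rw [Real.sqrt_eq_rpow, ← Real.rpow_mul (noiseForm_self_nonneg hρ F)]
        congr 1; ring
    _ ≤ u ^ (1 - ρ) * (v ^ 2) ^ ρ := h
    _ = v ^ (1 + ρ) * (u / v) ^ (1 - ρ) := by
        rw [Real.div_rpow hu.le hv.le, ← Real.rpow_natCast, ← Real.rpow_mul hv.le, mul_div_left_comm,
          ← Real.rpow_sub hv]
        congr 2; push_cast; ring
    _ ≤ v ^ (1 + ρ) * (u / v) ^ ((1 - ρ) / 2 * (1 + ρ)) := by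
        refine mul_le_mul_of_nonneg_left ?_ (by positivity)
        exact Real.rpow_le_rpow_of_exponent_ge hr hr1 (by nlinarith)
    _ = _ := by
        rw [Real.mul_rpow hv.le (by positivity), ← Real.rpow_mul hr.le]

theorem abs_noiseForm_le_exp {n : ℕ} {ρ : ℝ} (hρ : 0 ≤ ρ) (hρ' : ρ ≤ 1)
    {F G : (Fin n → Bool) → ℝ} (hF : F ≠ 0) (hG : G ≠ 0) :
    |noiseForm ρ F G| ≤ lpNorm 2 F * lpNorm 2 G *
      Real.exp (-(Real.log (lpNorm 2 F * lpNorm 2 G / (lpNorm 1 F * lpNorm 1 G)) / 2 * (1 - ρ))) := by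
  have h1F := lpNorm_one_pos hF
  have h1G := lpNorm_one_pos hG
  have h2F := h1F.trans_le (lpNorm_one_le_lpNorm_two F)
  have h2G := h1G.trans_le (lpNorm_one_le_lpNorm_two G)
  refine (abs_noiseForm_le hρ F G).trans ((mul_le_mul (sqrt_noiseForm_self_le hρ hρ' hF)
    (sqrt_noiseForm_self_le hρ hρ' hG) (Real.sqrt_nonneg _) (by positivity)).trans (le_of_eq ?_))
  rw [mul_mul_mul_comm, ← Real.mul_rpow (by positivity) (by positivity), div_mul_div_comm,
    Real.rpow_def_of_pos (by positivity), ← inv_div, Real.log_inv]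
  congr 2
  ring

/-! ### Fourier coefficients of derivatives -/

theorem walsh_insert {n : ℕ} {i : Fin n} {U : Finset (Fin n)} (hi : i ∉ U) (x : Fin n → Bool) :
    walsh (insert i U) x = (-1) ^ (x i).toNat * walsh U x := by
  simp only [walsh_eq_prod, Finset.prod_insert hi]

theorem walsh_update {n : ℕ} {i : Fin n} {U : Finset (Fin n)} (hi : i ∉ U) (x : Fin n → Bool)
    (b : Bool) : walsh U (Function.update x i b) = walsh U x := by
  simp only [walsh_eq_prod]
  refine Finset.prod_congr rfl fun j hj => ?_
  rw [Function.update_of_ne (ne_of_mem_of_not_mem hj hi)]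

theorem partialDeriv_eq {n : ℕ} (i : Fin n) (f : (Fin n → Bool) → ℝ) (x : Fin n → Bool) :
    partialDeriv i f x = (-1) ^ (x i).toNat * (f (Function.update x i (!x i)) - f x) := by
  have hx := Function.update_eq_self i x
  cases h : x i <;> rw [h] at hx <;> simp [partialDeriv, hx]

theorem sum_update_not {n : ℕ} (i : Fin n) (F : (Fin n → Bool) → ℝ) :
    ∑ x, F (Function.update x i (!x i)) = ∑ x, F x :=
  Equiv.sum_comp (Function.Involutive.toPerm
    (fun x : Fin n → Bool => Function.update x i (!x i)) fun x => by simp) F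

/-- By `partialDeriv_eq`, the derivative is the character of `i` times the flip difference. Flip
invariance of the sum kills the coefficient if that character cancels against `U`, and doubles it
with a sign otherwise. -/
theorem fourier_partialDeriv {n : ℕ} (i : Fin n) (f : (Fin n → Bool) → ℝ) (U : Finset (Fin n)) :
    fourier (partialDeriv i f) U = if i ∈ U then 0 else -2 * fourier f (insert i U) := by
  have hsgn : ∀ b : Bool, (-1 : ℝ) ^ (!b).toNat = -(-1) ^ b.toNat := by
    intro b; cases b <;> simp
  have hsq : ∀ b : Bool, (-1 : ℝ) ^ b.toNat * (-1) ^ b.toNat = 1 := by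
    intro b; cases b <;> simp
  -- Both cases use this change of variables: `c` is constant when `i ∈ U` and the sign of the bit
  -- when `i ∉ U`.
  have hw : ∀ V : Finset (Fin n), i ∉ V → ∀ c : Bool → ℝ,
      ∑ x, f (Function.update x i (!x i)) * (c (x i) * walsh V x) =
        ∑ x, f x * (c (!x i) * walsh V x) := by
    intro V hV c
    rw [← sum_update_not i fun x => f x * (c (!x i) * walsh V x)]
    refine Finset.sum_congr rfl fun x _ => ?_
    rw [walsh_update hV, Function.update_self, Bool.not_not]
  rw [fourier, fourier, expect, expect]
  split_ifs with hi
  · obtain ⟨V, hV, rfl⟩ : ∃ V, i ∉ V ∧ insert i V = U :=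
      ⟨U.erase i, Finset.notMem_erase i U, Finset.insert_erase hi⟩
    have h := hw V hV fun _ => 1
    rw [div_eq_zero_iff]
    left
    rw [← sub_eq_zero, ← Finset.sum_sub_distrib] at h
    rw [← h]
    refine Finset.sum_congr rfl fun x _ => ?_
    rw [walsh_insert hV, partialDeriv_eq]
    linear_combination (f (Function.update x i (!x i)) - f x) * walsh V x * hsq (x i)
  · have h := hw U hi fun b => (-1) ^ b.toNat
    rw [← mul_div_assoc]
    congr 1
    have e : ∑ x, partialDeriv i f x * walsh U x =
        ∑ x, f (Function.update x i (!x i)) * ((-1) ^ (x i).toNat * walsh U x) -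
          ∑ x, f x * ((-1) ^ (x i).toNat * walsh U x) := by
      rw [← Finset.sum_sub_distrib]
      refine Finset.sum_congr rfl fun x _ => ?_
      rw [partialDeriv_eq]
      ring
    rw [e, h, ← Finset.sum_sub_distrib, Finset.mul_sum]
    refine Finset.sum_congr rfl fun x _ => ?_
    rw [hsgn, walsh_insert hi]
    ring

theorem iterDeriv_insert {n : ℕ} {i : Fin n} {T : Finset (Fin n)} (hi : i ∉ T)
    (f : (Fin n → Bool) → ℝ) : iterDeriv (insert i T) f = partialDeriv i (iterDeriv T f) := by
  rw [iterDeriv, Finset.insert_val_of_notMem hi, Multiset.foldr_cons, iterDeriv]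

theorem fourier_iterDeriv {n : ℕ} (T : Finset (Fin n)) (f : (Fin n → Bool) → ℝ) :
    ∀ U : Finset (Fin n), fourier (iterDeriv T f) U =
      if Disjoint U T then (-2) ^ T.card * fourier f (U ∪ T) else 0 := by
  induction T using Finset.induction_on with
  | empty => intro U; simp [iterDeriv]
  | insert i T hi ih =>
    intro U
    rw [iterDeriv_insert hi, fourier_partialDeriv, ih, Finset.card_insert_of_notMem hi, Finset.insert_union,
      Finset.union_insert]
    simp only [Finset.disjoint_insert_left, Finset.disjoint_insert_right]
    by_cases h1 : i ∈ U <;> by_cases h2 : Disjoint U T <;> simp [h1, h2, hi, pow_succ] <;> ring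

theorem noiseForm_iterDeriv {n : ℕ} (ρ : ℝ) (T : Finset (Fin n)) (f g : (Fin n → Bool) → ℝ) :
    noiseForm ρ (iterDeriv T f) (iterDeriv T g) =
      4 ^ T.card * ∑ S : Finset (Fin n) with T ⊆ S,
        ρ ^ (S.card - T.card) * (fourier f S * fourier g S) := by
  have h4 : (4 : ℝ) ^ T.card = (-2) ^ T.card * (-2) ^ T.card := by rw [← mul_pow]; norm_num
  have e : noiseForm ρ (iterDeriv T f) (iterDeriv T g) =
      ∑ U : Finset (Fin n) with Disjoint U T,
        4 ^ T.card * (ρ ^ U.card * (fourier f (U ∪ T) * fourier g (U ∪ T))) := by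
    rw [noiseForm, Finset.sum_filter]
    refine Finset.sum_congr rfl fun U _ => ?_
    rw [fourier_iterDeriv, fourier_iterDeriv]
    split_ifs
    · rw [h4]; ring
    · ring
  rw [e, Finset.mul_sum]
  refine Finset.sum_bij' (fun U _ => U ∪ T) (fun S _ => S \ T) ?_ ?_ ?_ ?_ ?_
  · intro U _; simp
  · intro S _; simpa using Finset.sdiff_disjoint
  · intro U hU
    exact Finset.union_sdiff_cancel_right (by simpa using hU)
  · intro S hS
    exact Finset.sdiff_union_of_subset (by simpa using hS)
  · intro U hU
    rw [Finset.card_union_of_disjoint (by simpa using hU), Nat.add_sub_cancel]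

/-! ### Beta integral and the level identity -/

theorem integral_one_sub_pow_mul_pow (d : ℕ) : ∀ m : ℕ,
    ∫ ρ in (0 : ℝ)..1, (1 - ρ) ^ d * ρ ^ m = d.factorial * m.factorial / (d + m + 1).factorial := by
  induction d with
  | zero =>
    intro m
    simp [Nat.factorial_succ]
    field_simp
  | succ d ih =>
    intro m
    -- Integration by parts: both exponents are positive, so the boundary terms vanish and `d + 1,
    -- m` reduces to `d, m + 1`.
    have hd : ∀ ρ : ℝ, HasDerivAt (fun ρ : ℝ => (1 - ρ) ^ (d + 1) * ρ ^ (m + 1))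
        ((m + 1) * ((1 - ρ) ^ (d + 1) * ρ ^ m) - (d + 1) * ((1 - ρ) ^ d * ρ ^ (m + 1))) ρ := by
      intro ρ
      have h1 := ((hasDerivAt_id ρ).const_sub 1).fun_pow (d + 1)
      have h2 := hasDerivAt_pow (m + 1) ρ
      refine (h1.fun_mul h2).congr_deriv ?_
      simp
      ring
    have h := intervalIntegral.integral_eq_sub_of_hasDerivAt (a := 0) (b := 1)
      (fun ρ _ => hd ρ) (Continuous.intervalIntegrable (by fun_prop) _ _)
    rw [intervalIntegral.integral_sub (Continuous.intervalIntegrable (by fun_prop) _ _)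
      (Continuous.intervalIntegrable (by fun_prop) _ _), intervalIntegral.integral_const_mul,
      intervalIntegral.integral_const_mul, ih] at h
    simp only [sub_self, zero_pow (Nat.succ_ne_zero _), mul_zero, zero_mul] at h
    rw [show d + (m + 1) + 1 = d + 1 + m + 1 by ring, Nat.factorial_succ m] at h
    rw [Nat.factorial_succ d]
    push_cast at h ⊢
    have hm : (m + 1 : ℝ) ≠ 0 := by positivity
    apply mul_left_cancel₀ hm
    linear_combination h

theorem choose_mul_integral {k d : ℕ} (hd : d ≠ 0) (hdk : d ≤ k) :
    (k.choose d : ℝ) * ∫ ρ in (0 : ℝ)..1, d * (1 - ρ) ^ (d - 1) * ρ ^ (k - d) = 1 := by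
  obtain ⟨d, rfl⟩ := Nat.exists_eq_succ_of_ne_zero hd
  simp only [mul_assoc, intervalIntegral.integral_const_mul]
  rw [Nat.succ_sub_one, integral_one_sub_pow_mul_pow, Nat.cast_choose ℝ hdk,
    show d + (k - d.succ) + 1 = k by omega, Nat.factorial_succ]
  have := Nat.factorial_ne_zero (k - d.succ)
  have := Nat.factorial_ne_zero k
  have := Nat.factorial_ne_zero d
  push_cast
  field_simp

/-- After exchanging the sums, `S` occurs once for each of its `d`-subsets `T`, and
`choose_mul_integral` normalises the total. -/
theorem level_sum_eq {n d : ℕ} (hd : d ≠ 0) (f g : (Fin n → Bool) → ℝ) :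
    4 ^ d * ∑ S : Finset (Fin n) with d ≤ S.card, fourier f S * fourier g S =
      ∑ T : Finset (Fin n) with T.card = d,
        ∫ ρ in (0 : ℝ)..1, d * (1 - ρ) ^ (d - 1) * noiseForm ρ (iterDeriv T f) (iterDeriv T g) := by
  have e : ∀ T ∈ Finset.univ.filter fun T : Finset (Fin n) => T.card = d,
      ∫ ρ in (0 : ℝ)..1, d * (1 - ρ) ^ (d - 1) * noiseForm ρ (iterDeriv T f) (iterDeriv T g) =
      ∑ S : Finset (Fin n), if T ⊆ S then 4 ^ d * (fourier f S * fourier g S) *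
        ∫ ρ in (0 : ℝ)..1, d * (1 - ρ) ^ (d - 1) * ρ ^ (S.card - d) else 0 := by
    intro T hT
    rw [Finset.mem_filter_univ] at hT
    rw [← Finset.sum_filter]
    simp only [← intervalIntegral.integral_const_mul]
    rw [← intervalIntegral.integral_finsetSum
      fun S _ => Continuous.intervalIntegrable (by fun_prop) _ _]
    congr 1
    funext ρ
    rw [noiseForm_iterDeriv, hT, Finset.mul_sum, Finset.mul_sum]
    refine Finset.sum_congr rfl fun S _ => ?_
    ring
  rw [Finset.sum_congr rfl e, Finset.sum_comm, Finset.mul_sum, Finset.sum_filter]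
  refine Finset.sum_congr rfl fun S _ => ?_
  have hc : (Finset.univ.filter fun T : Finset (Fin n) => T.card = d).filter (· ⊆ S) =
      S.powersetCard d := by
    ext T; simp [Finset.mem_powersetCard, and_comm]
  rw [← Finset.sum_filter, Finset.sum_const, hc, Finset.card_powersetCard, nsmul_eq_mul]
  split_ifs with h
  · linear_combination (-(4 ^ d * (fourier f S * fourier g S))) * choose_mul_integral hd h
  · rw [Nat.choose_eq_zero_of_lt (not_le.1 h), Nat.cast_zero, zero_mul]

/-! ### Integrating the exponential decay -/

theorem integral_pow_mul_exp_le_one {d : ℕ} (hd : d ≠ 0) {L : ℝ} (hL : 0 ≤ L) :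
    ∫ s in (0 : ℝ)..1, d * s ^ (d - 1) * Real.exp (-(L * s)) ≤ 1 := by
  have hd' : (d : ℝ) ≠ 0 := Nat.cast_ne_zero.2 hd
  calc ∫ s in (0 : ℝ)..1, d * s ^ (d - 1) * Real.exp (-(L * s))
      ≤ ∫ s in (0 : ℝ)..1, d * s ^ (d - 1) := by
        refine intervalIntegral.integral_mono_on zero_le_one
          (Continuous.intervalIntegrable (by fun_prop) _ _)
          (Continuous.intervalIntegrable (by fun_prop) _ _) fun s hs => ?_
        have : 0 ≤ s := hs.1
        exact mul_le_of_le_one_right (by positivity)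
          (Real.exp_le_one_iff.2 (neg_nonpos.2 (mul_nonneg hL hs.1)))
    _ = 1 := by
        rw [intervalIntegral.integral_const_mul, integral_pow]
        obtain ⟨d, rfl⟩ := Nat.exists_eq_succ_of_ne_zero hd
        simp at hd' ⊢
        field_simp

theorem integral_pow_mul_exp_le_factorial {d : ℕ} (hd : d ≠ 0) {L : ℝ} (hL : 0 < L) :
    ∫ s in (0 : ℝ)..1, d * s ^ (d - 1) * Real.exp (-(L * s)) ≤ d.factorial / L ^ d := by
  obtain ⟨d, rfl⟩ := Nat.exists_eq_succ_of_ne_zero hd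
  have hG := Real.integral_rpow_mul_exp_neg_mul_Ioi (a := (d + 1 : ℕ)) (by positivity) hL
  rw [show ((d + 1 : ℕ) : ℝ) - 1 = d by push_cast; ring, Nat.cast_succ, Real.Gamma_nat_eq_factorial,
    ← Nat.cast_succ, Real.rpow_natCast] at hG
  simp only [Real.rpow_natCast] at hG
  -- A non-integrable function has integral 0 by default, which the positive Gamma value excludes.
  have hint : IntegrableOn (fun s : ℝ => s ^ d * Real.exp (-(L * s))) (Set.Ioi 0) := by
    by_contra h
    rw [integral_undef h] at hG
    have : 0 < (1 / L) ^ d.succ * d.factorial := by positivity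
    exact this.ne hG
  have hle : ∫ s in (0 : ℝ)..1, s ^ d * Real.exp (-(L * s)) ≤ (1 / L) ^ d.succ * d.factorial := by
    rw [← hG, intervalIntegral.integral_of_le zero_le_one]
    refine setIntegral_mono_set hint ?_ Set.Ioc_subset_Ioi_self.eventuallyLE
    filter_upwards [ae_restrict_mem measurableSet_Ioi] with s hs
    have : 0 < s := hs
    positivity
  simp only [Nat.succ_sub_one, mul_assoc, intervalIntegral.integral_const_mul]
  calc _ ≤ (d.succ : ℝ) * ((1 / L) ^ d.succ * d.factorial) :=
        mul_le_mul_of_nonneg_left hle (by positivity)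
    _ = _ := by
        rw [Nat.factorial_succ, one_div, inv_pow]; push_cast; ring

/-- With `a = (2^d d!)^(1/d)`, the bounds `1` and `d!/(L/2)^d = (a/L)^d` cross at `L = a`. Below it
`1 + L ≤ 1 + a`; above it `(a/L)^d ≤ a/L`. -/
theorem integral_kernel_mul_exp_le {d : ℕ} (hd : d ≠ 0) {L : ℝ} (hL : 0 ≤ L) :
    ∫ ρ in (0 : ℝ)..1, d * (1 - ρ) ^ (d - 1) * Real.exp (-(L / 2 * (1 - ρ))) ≤
      (1 + ((2 : ℝ) ^ d * (d.factorial : ℝ)) ^ (1 / (d : ℝ))) / (1 + L) := by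
  have hsub := intervalIntegral.integral_comp_sub_left
    (fun s : ℝ => d * s ^ (d - 1) * Real.exp (-(L / 2 * s))) (1 : ℝ) (a := 0) (b := 1)
  rw [sub_self, sub_zero] at hsub
  rw [hsub]
  set a := ((2 : ℝ) ^ d * (d.factorial : ℝ)) ^ (1 / (d : ℝ)) with ha
  have ha0 : 0 < a := by positivity
  have had : a ^ d = 2 ^ d * d.factorial := by
    rw [ha, one_div, Real.rpow_inv_natCast_pow (by positivity) hd]
  rw [le_div_iff₀ (by linarith)]
  rcases le_total L a with h | h
  · have h1 := integral_pow_mul_exp_le_one hd (div_nonneg hL zero_le_two)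
    have := mul_le_mul_of_nonneg_right h1 (show 0 ≤ 1 + L by linarith)
    linarith
  · have hL' : 0 < L := ha0.trans_le h
    have h1 := integral_pow_mul_exp_le_factorial hd (half_pos hL')
    have h2 : d.factorial / (L / 2) ^ d ≤ a / L := by
      have e : d.factorial / (L / 2) ^ d = (a / L) ^ d := by
        rw [div_pow, div_pow, had]; field_simp
      rw [e]
      exact pow_le_of_le_one (by positivity) ((div_le_one hL').2 h) hd
    calc _ ≤ a / L * (1 + L) := mul_le_mul_of_nonneg_right (h1.trans h2) (by linarith)
      _ = a / L + a := by field_simp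
      _ ≤ 1 + a := by linarith [(div_le_one hL').2 h]

/-! ### Bound for a single `T` and conclusion -/

theorem continuous_noiseForm {n : ℕ} (F G : (Fin n → Bool) → ℝ) :
    Continuous fun ρ => noiseForm ρ F G := by
  unfold noiseForm
  fun_prop

theorem noiseForm_zero_left {n : ℕ} (ρ : ℝ) (G : (Fin n → Bool) → ℝ) : noiseForm ρ 0 G = 0 := by
  simp [noiseForm, fourier, expect]

theorem noiseForm_zero_right {n : ℕ} (ρ : ℝ) (F : (Fin n → Bool) → ℝ) : noiseForm ρ F 0 = 0 := by
  simp [noiseForm, fourier, expect]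

theorem lpNorm_two_zero {n : ℕ} : lpNorm 2 (0 : (Fin n → Bool) → ℝ) = 0 := by
  simp [lpNorm_two, expect]

theorem abs_integral_noiseForm_le {n d : ℕ} (hd : d ≠ 0) (F G : (Fin n → Bool) → ℝ) :
    |∫ ρ in (0 : ℝ)..1, d * (1 - ρ) ^ (d - 1) * noiseForm ρ F G| ≤
      (1 + ((2 : ℝ) ^ d * (d.factorial : ℝ)) ^ (1 / (d : ℝ))) *
        (lpNorm 2 F * lpNorm 2 G /
          (1 + Real.log (lpNorm 2 F * lpNorm 2 G / (lpNorm 1 F * lpNorm 1 G)))) := by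
  -- For a zero function the numerator on the right vanishes, so the default values in the quotient
  -- and logarithm are harmless.
  by_cases hF : F = 0
  · subst hF; simp [noiseForm_zero_left, lpNorm_two_zero]
  by_cases hG : G = 0
  · subst hG; simp [noiseForm_zero_right, lpNorm_two_zero]
  have h1F := lpNorm_one_pos hF
  have h1G := lpNorm_one_pos hG
  have hFF := lpNorm_one_le_lpNorm_two F
  have hGG := lpNorm_one_le_lpNorm_two G
  have hN : 0 ≤ lpNorm 2 F * lpNorm 2 G := mul_nonneg (h1F.le.trans hFF) (h1G.le.trans hGG)
  have hL : 0 ≤ Real.log (lpNorm 2 F * lpNorm 2 G / (lpNorm 1 F * lpNorm 1 G)) :=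
    Real.log_nonneg ((one_le_div (mul_pos h1F h1G)).2
      (mul_le_mul hFF hGG h1G.le (h1F.le.trans hFF)))
  have hpt := fun ρ (h0 : 0 ≤ ρ) (h1 : ρ ≤ 1) => abs_noiseForm_le_exp h0 h1 hF hG
  set N := lpNorm 2 F * lpNorm 2 G
  set L := Real.log (N / (lpNorm 1 F * lpNorm 1 G))
  have hcont := continuous_noiseForm F G
  calc |∫ ρ in (0 : ℝ)..1, d * (1 - ρ) ^ (d - 1) * noiseForm ρ F G|
      ≤ ∫ ρ in (0 : ℝ)..1, |d * (1 - ρ) ^ (d - 1) * noiseForm ρ F G| :=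
        intervalIntegral.abs_integral_le_integral_abs zero_le_one
    _ ≤ ∫ ρ in (0 : ℝ)..1, N * (d * (1 - ρ) ^ (d - 1) * Real.exp (-(L / 2 * (1 - ρ)))) := by
        refine intervalIntegral.integral_mono_on zero_le_one
          (Continuous.intervalIntegrable (by fun_prop) _ _)
          (Continuous.intervalIntegrable (by fun_prop) _ _) fun ρ hρ => ?_
        have hk : 0 ≤ d * (1 - ρ) ^ (d - 1) :=
          mul_nonneg (Nat.cast_nonneg d) (pow_nonneg (sub_nonneg.2 hρ.2) _)
        rw [abs_mul, abs_of_nonneg hk, mul_left_comm]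
        exact mul_le_mul_of_nonneg_left (hpt ρ hρ.1 hρ.2) hk
    _ ≤ N * ((1 + ((2 : ℝ) ^ d * (d.factorial : ℝ)) ^ (1 / (d : ℝ))) / (1 + L)) := by
        rw [intervalIntegral.integral_const_mul]
        exact mul_le_mul_of_nonneg_left (integral_kernel_mul_exp_le hd hL) hN
    _ = _ := by ring

end BoolCube

theorem mainTheorem7 (n d : ℕ) (hd : 2 ≤ d) (f g : (Fin n → Bool) → ℝ) :
    |∑ S : Finset (Fin n) with d ≤ S.card, BoolCube.fourier f S * BoolCube.fourier g S| ≤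
      BoolCube.levelConst d *
        ∑ T : Finset (Fin n) with T.card = d,
          BoolCube.lpNorm 2 (BoolCube.iterDeriv T f) * BoolCube.lpNorm 2 (BoolCube.iterDeriv T g) /
            (1 + Real.log
              (BoolCube.lpNorm 2 (BoolCube.iterDeriv T f) *
                  BoolCube.lpNorm 2 (BoolCube.iterDeriv T g) /
                (BoolCube.lpNorm 1 (BoolCube.iterDeriv T f) *
                  BoolCube.lpNorm 1 (BoolCube.iterDeriv T g)))) := by
  have hd0 : d ≠ 0 := by omega
  have h4 : (0 : ℝ) < 4 ^ d := by positivity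
  rw [BoolCube.levelConst, div_mul_eq_mul_div, le_div_iff₀ h4, mul_comm, ← abs_of_pos h4, ← abs_mul,
    BoolCube.level_sum_eq hd0, Finset.mul_sum]
  exact (Finset.abs_sum_le_sum_abs _ _).trans
    (Finset.sum_le_sum fun T _ => BoolCube.abs_integral_noiseForm_le hd0 _ _)
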